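/- Let $r\ge 1$, $n\ge 0$ and $d\ge 0$ be integers with $r\mid d$ and $d\le nr$. **Paths and parking functions.** An $r$-FSchröder path of base $n$ is a sequence of steps $(0,-1)$ (down), $(1,0)$ (right) and $(1,-r)$ (diagonal) from $(0,nr)$ to $(n,0)$ that never goes above the line through $(0,nr)$ and $(n,0)$. Its coding is the word of length $nr$ that lists, row by row from the top, the left area of each row, i.e. the number of full unit squares of that row between the $y$-axis and the path: a down step at abscissa $k$ contributes the letter $k$, and a diagonal step starting at abscissa $k$ contributes $r$ barred letters $\bar k$. A parking function on the $r$-FSchröder paths with $d$ down steps is any rearrangement of the coding of such a path of base $n$ with exactly $d$ down steps; let $\mathrm{Psch}^r_{n,d}$ be the number of these words. **The function $G$.** For integers $a,b,q\ge 0$ and rational $p\ge 0$ define recursively $$G(a,b,p,r,q)=\begin{cases}(b+1)^a & \text{if } a=0,\ b=0 \text{ or } p\ge b,\\[4pt] \displaystyle\sum_{w=0}^{q} b^{\,a-q+w}\binom{a}{q-w} & \text{otherwise, if } a-q\le r,\\[8pt] \displaystyle\sum_{w=0}^{q}(\lfloor p\rfloor+1)^{a-w}(b-\lfloor p\rfloor)^w\binom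 aw+\sum_{t=q+1}^{q+(b-\lfloor p\rfloor-1)r}(\lfloor p\rfloor+1)^{a-t}\binom at\,G\!\left(t,\;b-\lfloor p\rfloor-1,\;b-\lfloor p\rfloor-\tfrac{t-q}{r}-1,\;r,\;q\right) & \text{otherwise.}\end{cases}$$ (The first case is that in which the pentagon with vertices $(0,0),(0,a),(p,a),(b,q),(b,0)$ is a rectangle or a segment.) **The sums $F_i$.** For $i\ge 0$ let $$F_i=\sum_{\alpha,\beta}\binom{d}{\alpha_1,\dots,\alpha_i}\prod_{k=1}^{i}G(\alpha_k,\beta_k,p_k,r,q_k)\;\chi(\alpha_k\ne 0\text{ or }\beta_k\neq 0)\;\chi(q_k\ge 0),$$ where $\alpha=(\alpha_1,\dots,\alpha_i)$ and $\beta=(\beta_1,\dots,\beta_i)$ run over the sequences of $i$ nonnegative integers with sum $d$ and $d/r$ respectively, $\chi$ is $1$ if its argument is true and $0$ otherwise (a product with a zero factor $\chi$ is $0$), and $$p_k=\min\Big(\beta_k,\ \sum_{j=1}^{k-1}\big(\tfrac{\alpha_j}{r}-\beta_j\big)\Big),\qquad q_k=\sum_{j=1}^{k}(\alpha_j-r\beta_j).$$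 **Proposition.** The number of parking functions is finite and equals $$\mathrm{Psch}^r_{n,d}=\binom{nr}{d,\underbrace{r,\dots,r}_{n-d/r}}\ \sum_{i=0}^{d+d/r}\binom{n-d/r+1}{i}\,F_i .$$ -/

import Mathlib

open Finset

/-- The three kinds of steps of an `r`-FSchröder path: `down` is `(0,-1)`, `right` is `(1,0)`,
`diag` is `(1,-r)`. -/
inductive FStep where
  | down : FStep
  | right : FStep
  | diag : FStep
  deriving DecidableEq

/-- Horizontal displacement of a step. -/
def FStep.dx : FStep → ℤ
  | .down => 0
  | .right => 1
  | .diag => 1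

/-- Vertical displacement of a step. -/
def FStep.dy (r : ℕ) : FStep → ℤ
  | .down => -1
  | .right => 0
  | .diag => -(r : ℤ)

/-- Abscissa of the point reached from `(0, n * r)` by the steps `w`. -/
def endX (w : List FStep) : ℤ := (w.map FStep.dx).sum

/-- Ordinate of the point reached from `(0, n * r)` by the steps `w`. -/
def endY (n r : ℕ) (w : List FStep) : ℤ := (n : ℤ) * r + (w.map (FStep.dy r)).sum

/-- An `r`-FSchröder path of base `n`: a sequence of steps from `(0, n * r)` to `(n, 0)` that never
goes above the line `r * x + y = n * r` through these two points. Since the half-plane below the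
line is convex, it is enough to test the points between consecutive steps. -/
def IsFSchroder (n r : ℕ) (w : List FStep) : Prop :=
  endX w = n ∧ endY n r w = 0 ∧
    ∀ u : List FStep, u <+: w → (r : ℤ) * endX u + endY n r u ≤ (n : ℤ) * r

/-- The `r`-FSchröder paths of base `n` that have `d` down steps. -/
def FSch (n d r : ℕ) : Set (List FStep) :=
  {w | IsFSchroder n r w ∧ w.count FStep.down = d}

/-- Letters of the coding of a path: a left area `k`, or a barred left area. -/
inductive AreaLetter where
  | plain : ℕ → AreaLetter
  | barred : ℕ → AreaLetter
  deriving DecidableEq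

/-- Coding by left areas, row by row from the top, of a path that starts at abscissa `x`. A down
step at abscissa `x` occupies one row, with `x` full squares to its left. A diagonal step from
abscissa `x` occupies `r` rows, each with `x` full squares to its left; these are barred. -/
def areaCodeFrom (r : ℕ) : ℕ → List FStep → List AreaLetter
  | _, [] => []
  | x, .down :: w => AreaLetter.plain x :: areaCodeFrom r x w
  | x, .right :: w => areaCodeFrom r (x + 1) w
  | x, .diag :: w => List.replicate r (AreaLetter.barred x) ++ areaCodeFrom r (x + 1) w

/-- Coding by left areas of an `r`-FSchröder path. -/
def areaCode (r : ℕ) (w : List FStep) : List AreaLetter := areaCodeFrom r 0 w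

/-- The parking functions on the `r`-FSchröder paths with base `n` and `d` down steps: the
sequences of plain or barred numbers which are a rearrangement of the coding of such a path. -/
def parkingFSch (n d r : ℕ) : Set (List AreaLetter) :=
  {P | ∃ w ∈ FSch n d r, P.Perm (areaCode r w)}

/-- The recursive function `G(a,b,p,r,q)`, attached to the (possibly degenerate) pentagon with
vertices `(0,0)`, `(0,a)`, `(p,a)`, `(b,q)`, `(b,0)`. The pentagon is a rectangle when `p = b`;
the vertical and horizontal segments `b = 0` and `a = 0` count as rectangles. -/
def pentG (a b : ℕ) (p : ℚ) (r q : ℕ) : ℕ :=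
  if a = 0 ∨ b = 0 ∨ (b : ℚ) ≤ p then (b + 1) ^ a
  else if a ≤ q + r then
    ∑ w ∈ range (q + 1), b ^ (a - q + w) * a.choose (q - w)
  else
    ∑ w ∈ range (q + 1), (⌊p⌋₊ + 1) ^ (a - w) * (b - ⌊p⌋₊) ^ w * a.choose w
    + ∑ t ∈ Icc (q + 1) (q + (b - ⌊p⌋₊ - 1) * r),
        (⌊p⌋₊ + 1) ^ (a - t) * a.choose t *
          pentG t (b - ⌊p⌋₊ - 1) ((b : ℚ) - ⌊p⌋₊ - ((t : ℚ) - q) / r - 1) r q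
termination_by b
decreasing_by omega

/-- `∑_{j<k} (α_j / r - β_j)`. -/
def prevWidth (r : ℕ) {i : ℕ} (α β : Fin i → ℕ) (k : Fin i) : ℚ :=
  ∑ j ∈ Finset.Iio k, ((α j : ℚ) / r - β j)

/-- `∑_{j≤k} (α_j - r β_j)`. -/
def lowHeight (r : ℕ) {i : ℕ} (α β : Fin i → ℕ) (k : Fin i) : ℤ :=
  ∑ j ∈ Finset.Iic k, ((α j : ℤ) - r * β j)

/-- `F_i`: the sum over the weak compositions `α` of `d` and `β` of `d / r` into `i` parts. -/
def sumF (d r i : ℕ) : ℕ :=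
  ∑ α ∈ Finset.Nat.antidiagonalTuple i d, ∑ β ∈ Finset.Nat.antidiagonalTuple i (d / r),
    Nat.multinomial univ α *
      ∏ k : Fin i,
        pentG (α k) (β k) (min (β k : ℚ) (prevWidth r α β k)) r (lowHeight r α β k).toNat
          * (if α k ≠ 0 ∨ β k ≠ 0 then 1 else 0)
          * (if 0 ≤ lowHeight r α β k then 1 else 0)

/-! The slack `n * r - r * x - y` of a point below the boundary line grows by 1 at a down step,
drops by `r` at a right step and is unchanged by a diagonal step. Only right steps can break the
boundary condition.

A path is determined by its width and the multiset of letters of its coding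
(`eq_of_areaCodeFrom_perm`), so different paths give disjoint sets of words. With `m = n - d / r`
diagonal steps and `c_x` down steps on abscissa `x`, a path gives `(n * r)! / (r! ^ m * ∏ c_x!)`
words. It remains to sum `∏ 1 / c_x!` over the paths.

The diagonal steps cut a path into `m + 1` blocks of down and right steps. No two blocks share an
abscissa, so the weight is a product over the blocks, each depending on the past only through its
initial slack. Empty blocks have weight 1 and keep the slack; placing the `i` nonempty ones gives
the factor `(m + 1).choose i` (`chainWeight_eq_sum_choose`).

For a block with initial slack `s`, put `p = min b (s / r)` and let `q` be its final slack. Then `G`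
is `a!` times the block weight (`pentG_eq`), and these factorials turn `d!` into the multinomial
coefficient of `F_i` (`sumF_eq_factorial_mul`). -/

/-! ### Weights of single blocks. -/

/-- Exponential weight of the blocks of `b` right steps and `a` down steps that start with slack `s`
below the boundary line: the sum of `∏ 1 / (c_x)!` over the numbers `c_x` of down steps on the
`b + 1` abscissas. On the first abscissa `c` down steps have been made already. -/
def blockWeight (r : ℕ) : ℕ → ℕ → ℕ → ℤ → ℚ
  | c, 0, a, _ => 1 / ((c + a).factorial : ℚ)
  | c, b + 1, a, s => ∑ x ∈ antidiagonal a, 1 / ((c + x.1).factorial : ℚ) *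
      if (r : ℤ) ≤ s + x.1 then blockWeight r 0 b x.2 (s + x.1 - r) else 0

theorem blockWeight_zero_right (r c a : ℕ) (s : ℤ) :
    blockWeight r c 0 a s = 1 / ((c + a).factorial : ℚ) := by
  simp [blockWeight]

theorem blockWeight_succ_right (r c b a : ℕ) (s : ℤ) :
    blockWeight r c (b + 1) a s = ∑ x ∈ antidiagonal a, 1 / ((c + x.1).factorial : ℚ) *
      if (r : ℤ) ≤ s + x.1 then blockWeight r 0 b x.2 (s + x.1 - r) else 0 := by
  simp [blockWeight]

theorem blockWeight_succ_zero (r c b : ℕ) (s : ℤ) :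
    blockWeight r c (b + 1) 0 s = 1 / (c.factorial : ℚ) *
      if (r : ℤ) ≤ s then blockWeight r 0 b 0 (s - r) else 0 := by
  simp [blockWeight]

theorem blockWeight_zero_succ (r c a : ℕ) (s : ℤ) :
    blockWeight r c 0 (a + 1) s = blockWeight r (c + 1) 0 a (s + 1) := by
  rw [blockWeight_zero_right, blockWeight_zero_right]
  congr 3; ring

/-- The first step is either right or down. A first down step stays on the same abscissa, so it must
enter the same factorial: this is what `c` records. -/
theorem blockWeight_succ_succ (r c b a : ℕ) (s : ℤ) :
    blockWeight r c (b + 1) (a + 1) s = 1 / (c.factorial : ℚ) *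
      (if (r : ℤ) ≤ s then blockWeight r 0 b (a + 1) (s - r) else 0) +
      blockWeight r (c + 1) (b + 1) a (s + 1) := by
  rw [blockWeight_succ_right, blockWeight_succ_right, Finset.Nat.sum_antidiagonal_succ]
  congr 1
  · simp
  · refine sum_congr rfl fun x _ => ?_
    have e : s + ((x.1 + 1 : ℕ) : ℤ) = s + 1 + x.1 := by push_cast; ring
    rw [e, show c + (x.1 + 1) = c + 1 + x.1 by ring]

/-- A block that ends above the boundary line has weight zero. -/
theorem blockWeight_eq_zero (r : ℕ) : ∀ (c b a : ℕ) (s : ℤ), 0 ≤ s → s + a - r * b < 0 →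
    blockWeight r c b a s = 0
  | c, 0, a, s, hs, h => by
    simp at h; omega
  | c, b + 1, a, s, hs, h => by
    rw [blockWeight_succ_right]
    refine sum_eq_zero fun x hx => ?_
    rw [HasAntidiagonal.mem_antidiagonal] at hx
    split_ifs with h1
    · rw [blockWeight_eq_zero r 0 b x.2 _ (by omega) (by
        push_cast [← hx] at h; linarith), mul_zero]
    · simp

/-- Splitting a block at the right step from abscissa `k`. -/
theorem blockWeight_split (r b : ℕ) : ∀ (k c a : ℕ) (s : ℤ),
    blockWeight r c (k + 1 + b) a s = ∑ x ∈ antidiagonal a, blockWeight r c k x.1 s *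
      if (r : ℤ) * (k + 1) ≤ s + x.1 then blockWeight r 0 b x.2 (s + x.1 - r * (k + 1)) else 0
  | 0, c, a, s => by
    rw [show 0 + 1 + b = b + 1 by ring, blockWeight_succ_right]
    simp [blockWeight_zero_right]
  | k + 1, c, a, s => by
    have e : k + 1 + 1 + b = (k + 1 + b) + 1 := by ring
    have step : ∀ (a : ℕ) (s : ℤ) , (if (r : ℤ) ≤ s then
          blockWeight r 0 (k + 1 + b) a (s - r) else 0) =
        ∑ x ∈ antidiagonal a, (if (r : ℤ) ≤ s then blockWeight r 0 k x.1 (s - r) else 0) *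
          if (r : ℤ) * ((k + 1 : ℕ) + 1) ≤ s + x.1 then
            blockWeight r 0 b x.2 (s + x.1 - r * ((k + 1 : ℕ) + 1)) else 0 := by
      intro a s
      split_ifs with h
      · rw [blockWeight_split r b k]
        refine sum_congr rfl fun x _ => ?_
        have e1 : s - r + x.1 - (r : ℤ) * (k + 1) = s + x.1 - r * ((k + 1 : ℕ) + 1) := by
          push_cast; ring
        rw [e1]
        congr 1
        refine if_congr ?_ rfl rfl
        rw [← sub_nonneg, e1, sub_nonneg]
      · simp
    -- Induction on the down steps: `step` treats a block that starts with a right step, `ih` one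
    -- that starts with a down step.
    induction a generalizing c s with
    | zero =>
      rw [e, blockWeight_succ_zero, step]
      simp [blockWeight_succ_zero, mul_assoc]
    | succ a ih =>
      rw [e, blockWeight_succ_succ, step, ← e, ih, Finset.Nat.sum_antidiagonal_succ (n := a),
        Finset.Nat.sum_antidiagonal_succ (n := a)]
      dsimp only
      rw [blockWeight_succ_zero, mul_add, add_assoc, mul_sum, ← sum_add_distrib]
      congr 1
      · simp [mul_assoc]
      · refine sum_congr rfl fun x _ => ?_
        rw [blockWeight_succ_succ, add_mul, mul_assoc]
        have e2 : s + ((x.1 + 1 : ℕ) : ℤ) = s + 1 + x.1 := by push_cast; ring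
        rw [e2]

/-- Without boundary condition the weight is that of all words on `b + 1` letters. -/
theorem blockWeight_rectangle (r : ℕ) : ∀ (b a : ℕ) (s : ℤ), (r : ℤ) * b ≤ s →
    blockWeight r 0 b a s = ((b : ℚ) + 1) ^ a / (a.factorial : ℚ)
  | 0, a, s, h => by simp [blockWeight_zero_right]
  | b + 1, a, s, h => by
    push_cast at h ⊢
    have hb : 0 ≤ (r : ℤ) * b := by positivity
    -- Binomial expansion of `(1 + (b + 1)) ^ a` by the number of down steps on the first abscissa.
    rw [blockWeight_succ_right, eq_div_iff (by positivity), sum_mul,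
      add_comm ((b : ℚ) + 1), (Commute.all _ _).add_pow']
    refine sum_congr rfl fun x hx => ?_
    rw [HasAntidiagonal.mem_antidiagonal] at hx
    rw [if_pos (by nlinarith), blockWeight_rectangle r b _ _ (by nlinarith)]
    have := Nat.add_choose_mul_factorial_mul_factorial x.1 x.2
    rw [hx] at this
    rw [← this, nsmul_eq_mul]
    have h1 : (x.1.factorial : ℚ) ≠ 0 := by positivity
    have h2 : (x.2.factorial : ℚ) ≠ 0 := by positivity
    rw [Nat.choose_symm_of_eq_add hx.symm]
    push_cast
    field_simp
    simp [mul_comm]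

/-! ### Chains of blocks. -/

/-- Weight of the sequences of `m` blocks, joined by steps parallel to the boundary line. -/
def chainWeight (r : ℕ) : ℕ → ℕ → ℕ → ℤ → ℚ
  | 0, a, b, _ => if a = 0 ∧ b = 0 then 1 else 0
  | m + 1, a, b, s => ∑ x ∈ antidiagonal a, ∑ y ∈ antidiagonal b,
      blockWeight r 0 y.1 x.1 s * chainWeight r m x.2 y.2 (s + x.1 - r * y.1)

/-- Weight of the sequences of `m` nonempty blocks. -/
def nonemptyChainWeight (r : ℕ) : ℕ → ℕ → ℕ → ℤ → ℚ
  | 0, a, b, _ => if a = 0 ∧ b = 0 then 1 else 0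
  | m + 1, a, b, s => ∑ x ∈ antidiagonal a, ∑ y ∈ antidiagonal b,
      (if x.1 ≠ 0 ∨ y.1 ≠ 0 then blockWeight r 0 y.1 x.1 s else 0) *
        nonemptyChainWeight r m x.2 y.2 (s + x.1 - r * y.1)

theorem sum_antidiagonal_zero_fst {M : Type*} [AddCommMonoid M] (n : ℕ) (f : ℕ × ℕ → M) :
    ∑ x ∈ antidiagonal n, (if x.1 = 0 then f x else 0) = f (0, n) := by
  rw [sum_eq_single (0, n)]
  · simp
  · intro x hx hne
    rw [HasAntidiagonal.mem_antidiagonal] at hx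
    refine if_neg fun h => hne ?_
    ext <;> simp <;> omega
  · simp

/-- Choose which of the `m` blocks are nonempty. In the induction the first block is either empty,
with weight 1 and no effect on the slack, or not; Pascal's rule recombines the two cases. -/
theorem chainWeight_eq_sum_choose (r : ℕ) : ∀ (m a b : ℕ) (s : ℤ),
    chainWeight r m a b s = ∑ i ∈ range (m + 1), (m.choose i : ℚ) * nonemptyChainWeight r i a b s
  | 0, a, b, s => by simp [chainWeight, nonemptyChainWeight]
  | m + 1, a, b, s => by
    have h0 : chainWeight r (m + 1) a b s = chainWeight r m a b s +
        ∑ x ∈ antidiagonal a, ∑ y ∈ antidiagonal b,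
          (if x.1 ≠ 0 ∨ y.1 ≠ 0 then blockWeight r 0 y.1 x.1 s else 0) *
            chainWeight r m x.2 y.2 (s + x.1 - r * y.1) := by
      have h1 : chainWeight r m a b s = ∑ x ∈ antidiagonal a, (if x.1 = 0 then
          ∑ y ∈ antidiagonal b, (if y.1 = 0 then blockWeight r 0 y.1 x.1 s *
            chainWeight r m x.2 y.2 (s + x.1 - r * y.1) else 0) else 0) := by
        rw [sum_antidiagonal_zero_fst a (fun x => ∑ y ∈ antidiagonal b,
            (if y.1 = 0 then blockWeight r 0 y.1 x.1 s *
            chainWeight r m x.2 y.2 (s + x.1 - r * y.1) else 0)),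
          sum_antidiagonal_zero_fst b (fun y => blockWeight r 0 y.1 0 s *
            chainWeight r m a y.2 (s + (0 : ℕ) - r * y.1))]
        simp [blockWeight_zero_right]
      rw [h1, ← sum_add_distrib, chainWeight]
      refine sum_congr rfl fun x _ => ?_
      by_cases hx : x.1 = 0
      · rw [if_pos hx, ← sum_add_distrib]
        refine sum_congr rfl fun y _ => ?_
        by_cases hy : y.1 = 0 <;> simp [hx, hy]
      · simp [hx]
    have h2 : ∑ x ∈ antidiagonal a, ∑ y ∈ antidiagonal b,
          (if x.1 ≠ 0 ∨ y.1 ≠ 0 then blockWeight r 0 y.1 x.1 s else 0) *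
            chainWeight r m x.2 y.2 (s + x.1 - r * y.1) =
        ∑ i ∈ range (m + 1), (m.choose i : ℚ) * nonemptyChainWeight r (i + 1) a b s := by
      simp_rw [chainWeight_eq_sum_choose r m, nonemptyChainWeight, mul_sum]
      rw [sum_comm' (s := range (m + 1)) (t' := antidiagonal a) (s' := fun _ => range (m + 1))
        (by simp [and_comm])]
      refine sum_congr rfl fun x _ => ?_
      rw [sum_comm]
      refine sum_congr rfl fun i _ => sum_congr rfl fun y _ => ?_
      ring
    rw [h0, h2, chainWeight_eq_sum_choose r m, sum_range_succ' _ (m + 1)]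
    simp_rw [Nat.choose_succ_succ]
    push_cast
    simp_rw [add_mul, sum_add_distrib]
    rw [sum_range_succ' (fun i => (m.choose i : ℚ) * nonemptyChainWeight r i a b s) m,
      sum_range_succ (fun i => (m.choose (i + 1) : ℚ) * nonemptyChainWeight r (i + 1) a b s) m]
    simp
    ring

/-- Each nonempty block uses at least one step. This is why the sum over `i` may stop at `d + d /
r`, whatever the number of blocks. -/
theorem nonemptyChainWeight_eq_zero (r : ℕ) : ∀ (i a b : ℕ) (s : ℤ), a + b < i →
    nonemptyChainWeight r i a b s = 0
  | 0, _, _, _, h => by omega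
  | i + 1, a, b, s, h => by
    rw [nonemptyChainWeight]
    refine sum_eq_zero fun x hx => sum_eq_zero fun y hy => ?_
    rw [HasAntidiagonal.mem_antidiagonal] at hx hy
    split_ifs with h1
    · rw [nonemptyChainWeight_eq_zero r i _ _ _ (by omega), mul_zero]
    · simp

theorem chainWeight_eq_sum_range (r m a b : ℕ) (s : ℤ) :
    chainWeight r m a b s =
      ∑ i ∈ range (a + b + 1), (m.choose i : ℚ) * nonemptyChainWeight r i a b s := by
  rw [chainWeight_eq_sum_choose]
  rcases le_total (m + 1) (a + b + 1) with h | h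
  · refine sum_subset (by simpa using h) fun i _ hi => ?_
    rw [Nat.choose_eq_zero_of_lt (by simpa using hi)]
    simp
  · refine (sum_subset (by simpa using h) fun i _ hi => ?_).symm
    rw [nonemptyChainWeight_eq_zero _ _ _ _ _ (by simpa using hi), mul_zero]

/-! ### The function `G` as a block weight. -/

/-- Here `k` plays the role of `⌊p⌋`: the initial slack pays for exactly `k` right steps, so the
block is unconstrained up to abscissa `k` and is cut at the next right step. With `t` down steps
after the cut, the slack there is `r * b + q - t`, which is nonnegative iff `t ≤ q + b * r`. For `t
≤ q` the rest is unconstrained too and contributes `(b + 1) ^ t`. -/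
theorem factorial_mul_blockWeight_split (r k b a q : ℕ) (s : ℤ) (hk : (r : ℤ) * k ≤ s)
    (hk' : s < r * (k + 1)) (hq : s + a = r * (k + 1 + b : ℕ) + q) :
    (a.factorial : ℚ) * blockWeight r 0 (k + 1 + b) a s =
      ∑ w ∈ range (q + 1), ((k : ℚ) + 1) ^ (a - w) * ((b : ℚ) + 1) ^ w * a.choose w +
      ∑ t ∈ Icc (q + 1) (q + b * r), ((k : ℚ) + 1) ^ (a - t) * a.choose t *
        (t.factorial * blockWeight r 0 b t (r * b + q - t)) := by
  push_cast at hq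
  have hle : q + b * r ≤ a := by zify; nlinarith
  rw [blockWeight_split, ← Finset.Nat.sum_antidiagonal_swap,
    Finset.Nat.sum_antidiagonal_eq_sum_range_succ_mk, mul_sum]
  have hterm : ∀ t ∈ range (a + 1), (a.factorial : ℚ) *
      (blockWeight r 0 k (t, a - t).swap.1 s *
        if (r : ℤ) * (k + 1) ≤ s + ((t, a - t).swap.1 : ℕ) then
          blockWeight r 0 b (t, a - t).swap.2 (s + ((t, a - t).swap.1 : ℕ) - r * (k + 1)) else 0) =
      ((k : ℚ) + 1) ^ (a - t) * a.choose t *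
        (if t ≤ q + b * r then t.factorial * blockWeight r 0 b t (r * b + q - t) else 0) := by
    intro t ht
    have hta : t ≤ a := by simpa [Nat.lt_succ_iff] using ht
    simp only [Prod.swap]
    rw [blockWeight_rectangle r k _ s hk]
    have e : s + ((a - t : ℕ) : ℤ) - r * (k + 1) = r * b + q - t := by
      push_cast [hta]; linarith
    have hiff : (r : ℤ) * (k + 1) ≤ s + ((a - t : ℕ) : ℤ) ↔ t ≤ q + b * r := by
      rw [← sub_nonneg, e]
      zify
      constructor <;> intro h <;> linarith
    rw [e, if_congr hiff rfl rfl]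
    have hc := Nat.choose_mul_factorial_mul_factorial hta
    rw [← hc]
    have h1 : (t.factorial : ℚ) ≠ 0 := by positivity
    have h2 : ((a - t).factorial : ℚ) ≠ 0 := by positivity
    push_cast
    split_ifs
    · field_simp
    · simp
  rw [sum_congr rfl hterm]
  have hsub : range (q + b * r + 1) ⊆ range (a + 1) := by
    simpa using hle
  rw [← sum_subset hsub fun t _ ht => by
    rw [if_neg (by simpa using ht), mul_zero]]
  rw [range_eq_Ico, ← sum_Ico_consecutive _ (Nat.zero_le (q + 1)) (by omega : q + 1 ≤ q + b * r + 1)]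
  congr 1
  · rw [← range_eq_Ico]
    refine sum_congr rfl fun t ht => ?_
    have htq : t ≤ q := by simpa [Nat.lt_succ_iff] using ht
    rw [if_pos (by omega), blockWeight_rectangle _ _ _ _ (by zify at htq; linarith)]
    have h1 : (t.factorial : ℚ) ≠ 0 := by positivity
    field_simp
  · refine sum_congr (by ext; simp) fun t ht => ?_
    rw [if_pos]
    simp at ht
    omega

theorem pentG_of_le {a b : ℕ} {p : ℚ} (r q : ℕ) (h : (b : ℚ) ≤ p) :
    pentG a b p r q = (b + 1) ^ a := by
  rw [pentG, if_pos (Or.inr (Or.inr h))]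

/-- `G` counts the labelled blocks when the pentagon is not a rectangle. -/
theorem pentG_eq_of_lt (r q : ℕ) (hr : 1 ≤ r) (b : ℕ) : ∀ (a : ℕ) (s : ℤ) (p : ℚ), 0 ≤ s →
    p = s / r → s + a = r * b + q → s < r * b →
    (pentG a b p r q : ℚ) = a.factorial * blockWeight r 0 b a s := by
  induction b using Nat.strong_induction_on with
  | _ b ih =>
  intro a s p hs hp hq hlt
  have hr0 : (0 : ℚ) < r := by exact_mod_cast hr
  have hp0 : 0 ≤ p := by
    rw [hp]; exact div_nonneg (by exact_mod_cast hs) hr0.le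
  have hpr : p * r = s := by rw [hp]; field_simp
  have hpb : p < b := by
    rw [hp, div_lt_iff₀ hr0, mul_comm]; exact_mod_cast hlt
  have hb0 : b ≠ 0 := by
    rintro rfl; simp at hlt; omega
  have ha0 : a ≠ 0 := by
    rintro rfl; simp at hq; omega
  have hkb : ⌊p⌋₊ < b := (Nat.floor_lt hp0).2 hpb
  have hk1 : (⌊p⌋₊ : ℚ) ≤ p := Nat.floor_le hp0
  have hk2 : p < ⌊p⌋₊ + 1 := Nat.lt_floor_add_one p
  obtain ⟨k, hk⟩ : ∃ k, k = ⌊p⌋₊ := ⟨_, rfl⟩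
  rw [← hk] at hkb hk1 hk2
  have hks : (r : ℤ) * k ≤ s := by
    have : (r : ℚ) * k ≤ s := by rw [← hpr, mul_comm]; gcongr
    exact_mod_cast this
  have hks' : s < (r : ℤ) * (k + 1) := by
    have : (s : ℚ) < r * (k + 1) := by rw [← hpr, mul_comm]; gcongr
    exact_mod_cast this
  obtain ⟨b', rfl⟩ : ∃ b', b = k + 1 + b' := ⟨b - k - 1, by omega⟩
  rw [factorial_mul_blockWeight_split r k b' a q s hks hks' hq]
  rw [pentG, if_neg (by push Not; exact ⟨ha0, hb0, hpb⟩), ← hk]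
  push_cast at hq
  have hqa : q ≤ a := by zify; push_cast at hlt; linarith
  split_ifs with h
  -- Since `s < r * (k + 1)`, `a - q > r * b'`; with `a - q ≤ r` no right step remains after the
  -- cut.
  · have hb' : b' = 0 := by
      by_contra hne
      have h1 : (1 : ℤ) ≤ b' := by omega
      zify at h
      nlinarith
    subst hb'
    rw [← sum_range_reflect]
    simp only [add_zero, zero_mul]
    rw [Icc_eq_empty (by omega), sum_empty, add_zero]
    push_cast
    refine sum_congr rfl fun w hw => ?_
    have hwq : w ≤ q := by simpa [Nat.lt_succ_iff] using hw
    rw [show a - q + (q - w) = a - w by omega, show q - (q - w) = w by omega]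
    simp
  · rw [show k + 1 + b' - k = b' + 1 by omega, show b' + 1 - 1 = b' by omega]
    push_cast
    congr 1
    refine sum_congr rfl fun t ht => ?_
    simp only [mem_Icc] at ht
    have ht1 : (t : ℤ) ≤ q + b' * r := by exact_mod_cast ht.2
    have ht2 : (q : ℤ) + 1 ≤ t := by exact_mod_cast ht.1
    -- The third argument of the recursive call is the new slack `r * b' + q - t` divided by `r`;
    -- the bounds on `t` place this slack in `[0, r * b')`.
    rw [ih b' (by omega) t (r * b' + q - t) _ (by linarith) ?_ (by ring) (by linarith)]
    push_cast
    field_simp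
    ring

/-- `G` counts the labelled blocks. -/
theorem pentG_eq (r q : ℕ) (hr : 1 ≤ r) (b a : ℕ) (s : ℤ) (hs : 0 ≤ s)
    (hq : s + a = r * b + q) :
    (pentG a b (min (b : ℚ) (s / r)) r q : ℚ) = a.factorial * blockWeight r 0 b a s := by
  have hr0 : (0 : ℚ) < r := by exact_mod_cast hr
  rcases lt_or_ge s (r * b) with h | h
  · refine pentG_eq_of_lt r q hr b a s _ hs ?_ hq h
    refine min_eq_right ?_
    rw [div_le_iff₀ hr0, mul_comm]
    exact_mod_cast h.le
  · rw [pentG_of_le, blockWeight_rectangle _ _ _ _ h]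
    · have : (a.factorial : ℚ) ≠ 0 := by positivity
      push_cast
      field_simp
    · refine le_min le_rfl ?_
      rw [le_div_iff₀ hr0, mul_comm]
      exact_mod_cast h

/-! ### The sums `F_i` as weights of chains of nonempty blocks. -/

theorem sum_antidiagonalTuple_succ {M : Type*} [AddCommMonoid M] (i n : ℕ)
    (f : (Fin (i + 1) → ℕ) → M) :
    ∑ α ∈ Finset.Nat.antidiagonalTuple (i + 1) n, f α =
      ∑ x ∈ antidiagonal n, ∑ α ∈ Finset.Nat.antidiagonalTuple i x.2, f (Fin.cons x.1 α) := by
  rw [sum_sigma']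
  refine sum_nbij' (fun α => ⟨(α 0, ∑ j, α (Fin.succ j)), Fin.tail α⟩)
    (fun y => Fin.cons y.1.1 y.2) ?_ ?_ ?_ ?_ ?_
  · intro α hα
    rw [Finset.Nat.mem_antidiagonalTuple, Fin.sum_univ_succ] at hα
    simp [Finset.Nat.mem_antidiagonalTuple, hα, Fin.tail]
  · rintro ⟨⟨x, y⟩, α⟩ h
    simp only [mem_sigma, HasAntidiagonal.mem_antidiagonal,
      Finset.Nat.mem_antidiagonalTuple] at h
    simp [Finset.Nat.mem_antidiagonalTuple, Fin.sum_univ_succ, h.1, h.2]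
  · intro α _
    simp
  · rintro ⟨⟨x, y⟩, α⟩ h
    simp only [mem_sigma, HasAntidiagonal.mem_antidiagonal,
      Finset.Nat.mem_antidiagonalTuple] at h
    obtain ⟨h1, rfl⟩ := h
    simp
  · intro α _
    simp

theorem Fin.sum_Iio_succ {M : Type*} [AddCommMonoid M] {i : ℕ} (f : Fin (i + 1) → M) (k : Fin i) :
    ∑ j ∈ Finset.Iio k.succ, f j = f 0 + ∑ j ∈ Finset.Iio k, f j.succ := by
  have h : ∀ {m : ℕ} (g : Fin m → M) (k : Fin m),
      ∑ j ∈ Finset.Iio k, g j = ∑ j, if j < k then g j else 0 := by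
    intro m g k
    rw [← sum_filter]
    congr 1
    ext; simp
  rw [h, h, Fin.sum_univ_succ]
  simp

theorem Fin.sum_Iic_succ {M : Type*} [AddCommMonoid M] {i : ℕ} (f : Fin (i + 1) → M) (k : Fin i) :
    ∑ j ∈ Finset.Iic k.succ, f j = f 0 + ∑ j ∈ Finset.Iic k, f j.succ := by
  have h : ∀ {m : ℕ} (g : Fin m → M) (k : Fin m),
      ∑ j ∈ Finset.Iic k, g j = ∑ j, if j ≤ k then g j else 0 := by
    intro m g k
    rw [← sum_filter]
    congr 1
    ext; simp
  rw [h, h, Fin.sum_univ_succ]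
  simp

theorem Fin.sum_Iic_zero {M : Type*} [AddCommMonoid M] {i : ℕ} (f : Fin (i + 1) → M) :
    ∑ j ∈ Finset.Iic (0 : Fin (i + 1)), f j = f 0 := by
  have : Finset.Iic (0 : Fin (i + 1)) = {0} := by ext; simp
  rw [this, sum_singleton]

theorem Fin.sum_Iio_zero {M : Type*} [AddCommMonoid M] {i : ℕ} (f : Fin (i + 1) → M) :
    ∑ j ∈ Finset.Iio (0 : Fin (i + 1)), f j = 0 := by
  have : Finset.Iio (0 : Fin (i + 1)) = ∅ := by ext; simp
  rw [this, sum_empty]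

/-- Slack at the start of the `k`-th block. -/
def startSlack (r : ℕ) {i : ℕ} (α β : Fin i → ℕ) (k : Fin i) : ℤ :=
  ∑ j ∈ Finset.Iio k, ((α j : ℤ) - r * β j)

theorem lowHeight_eq_startSlack_add (r : ℕ) {i : ℕ} (α β : Fin i → ℕ) (k : Fin i) :
    lowHeight r α β k = startSlack r α β k + α k - r * β k := by
  unfold lowHeight startSlack
  rw [← Finset.Iio_insert, sum_insert (by simp)]
  ring

theorem prevWidth_eq_startSlack_div (r : ℕ) (hr : 1 ≤ r) {i : ℕ} (α β : Fin i → ℕ) (k : Fin i) :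
    prevWidth r α β k = (startSlack r α β k : ℚ) / r := by
  have hr0 : (r : ℚ) ≠ 0 := by positivity
  unfold prevWidth startSlack
  push_cast
  rw [sum_div]
  refine sum_congr rfl fun j _ => ?_
  field_simp

/-- The factor of the `k`-th block in the weight of a sequence of nonempty blocks. -/
def blockFactor (r : ℕ) (s : ℤ) {i : ℕ} (α β : Fin i → ℕ) (k : Fin i) : ℚ :=
  if (α k ≠ 0 ∨ β k ≠ 0) ∧ 0 ≤ s + lowHeight r α β k then
    blockWeight r 0 (β k) (α k) (s + startSlack r α β k) else 0

theorem blockFactor_cons_zero (r : ℕ) (s : ℤ) (hs : 0 ≤ s) {i : ℕ} (x y : ℕ) (α β : Fin i → ℕ) :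
    blockFactor r s (Fin.cons x α : Fin (i + 1) → ℕ) (Fin.cons y β) 0 =
      if x ≠ 0 ∨ y ≠ 0 then blockWeight r 0 y x s else 0 := by
  simp only [blockFactor, lowHeight, startSlack, Fin.sum_Iic_zero, Fin.sum_Iio_zero,
    Fin.cons_zero, add_zero]
  by_cases h : 0 ≤ s + ((x : ℤ) - r * y)
  · simp [h]
  · rw [blockWeight_eq_zero r 0 y x s hs (by linarith)]
    simp

theorem blockFactor_cons_succ (r : ℕ) (s : ℤ) {i : ℕ} (x y : ℕ) (α β : Fin i → ℕ) (k : Fin i) :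
    blockFactor r s (Fin.cons x α : Fin (i + 1) → ℕ) (Fin.cons y β) k.succ =
      blockFactor r (s + x - r * y) α β k := by
  simp only [blockFactor, lowHeight, startSlack, Fin.sum_Iic_succ, Fin.sum_Iio_succ,
    Fin.cons_zero, Fin.cons_succ, add_assoc, add_sub_assoc]

/-- The initial slack is kept general because removing the first block shifts it. If the shifted
slack is negative, the first block has weight zero and both sides vanish. -/
theorem sum_prod_blockFactor (r : ℕ) : ∀ (i a b : ℕ) (s : ℤ), 0 ≤ s →
    ∑ α ∈ Finset.Nat.antidiagonalTuple i a, ∑ β ∈ Finset.Nat.antidiagonalTuple i b,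
      ∏ k, blockFactor r s α β k = nonemptyChainWeight r i a b s
  | 0, a, b, s, _ => by
    cases a <;> cases b <;> simp [nonemptyChainWeight]
  | i + 1, a, b, s, hs => by
    rw [nonemptyChainWeight, sum_antidiagonalTuple_succ]
    refine sum_congr rfl fun x _ => ?_
    simp_rw [sum_antidiagonalTuple_succ i b]
    rw [sum_comm]
    refine sum_congr rfl fun y _ => ?_
    simp_rw [Fin.prod_univ_succ, blockFactor_cons_zero r s hs, blockFactor_cons_succ, ← mul_sum]
    by_cases h : 0 ≤ s + x.1 - r * y.1
    · rw [sum_prod_blockFactor r i _ _ _ h]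
    · rw [blockWeight_eq_zero r 0 y.1 x.1 s hs (by linarith)]
      simp

/-- A block starts with the slack with which the previous one ended. -/
theorem startSlack_nonneg (r : ℕ) {i : ℕ} (α β : Fin i → ℕ) (h : ∀ k, 0 ≤ lowHeight r α β k)
    (k : Fin i) : 0 ≤ startSlack r α β k := by
  cases i with
  | zero => exact k.elim0
  | succ i =>
    refine Fin.cases ?_ (fun k => ?_) k
    · simp [startSlack, Fin.sum_Iio_zero]
    · have : startSlack r α β k.succ = lowHeight r α β k.castSucc := by
        unfold startSlack lowHeight
        congr 1
      rw [this]; exact h _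

theorem sumF_eq_factorial_mul (d r i : ℕ) (hr : 1 ≤ r) :
    (sumF d r i : ℚ) = d.factorial * nonemptyChainWeight r i d (d / r) 0 := by
  rw [← sum_prod_blockFactor r i d (d / r) 0 le_rfl, sumF, mul_sum]
  push_cast
  refine sum_congr rfl fun α hα => ?_
  rw [Finset.Nat.mem_antidiagonalTuple] at hα
  rw [mul_sum]
  refine sum_congr rfl fun β _ => ?_
  have hm : (d.factorial : ℚ) =
      (∏ k, ((α k).factorial : ℚ)) * (Nat.multinomial univ α : ℚ) := by
    rw [← hα]
    exact_mod_cast (Nat.multinomial_spec univ α).symm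
  rw [hm, mul_comm (∏ k, ((α k).factorial : ℚ)), mul_assoc, ← prod_mul_distrib]
  congr 1
  by_cases h : ∀ k, 0 ≤ lowHeight r α β k
  · refine prod_congr rfl fun k _ => ?_
    have hk := h k
    have e := lowHeight_eq_startSlack_add r α β k
    rw [prevWidth_eq_startSlack_div r hr, pentG_eq r _ hr _ _ _ (startSlack_nonneg r α β h k)
      (by rw [Int.toNat_of_nonneg hk]; linarith)]
    simp [blockFactor, hk]
  · push Not at h
    obtain ⟨k, hk⟩ := h
    -- Once some block ends above the line, `G` need not equal the block weight at the later
    -- indices; both products vanish through the factor `k`.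
    rw [prod_eq_zero (mem_univ k) (by rw [if_neg (not_le.2 hk)]; simp)]
    rw [prod_eq_zero (mem_univ k)]
    rw [blockFactor, if_neg (fun h' => by linarith [h'.2]), mul_zero]

/-! ### Counting the rearrangements of a coding. -/

/-- Number of lists with a given multiset of letters. -/
theorem card_permutations_toFinset_mul {α : Type*} [DecidableEq α] : ∀ (n : ℕ) (l : List α),
    l.length = n →
    #l.permutations.toFinset * ∏ x ∈ l.toFinset, (l.count x).factorial = n.factorial
  | 0, l, h => by
    rw [List.length_eq_zero_iff] at h
    simp [h]
  | n + 1, l, h => by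
    have hS : l.permutations.toFinset = l.toFinset.biUnion fun x =>
        (l.erase x).permutations.toFinset.map ⟨List.cons x, List.cons_injective⟩ := by
      ext P
      simp only [List.mem_toFinset, List.mem_permutations, mem_biUnion, mem_map,
        Function.Embedding.coeFn_mk]
      constructor
      · intro hP
        cases P with
        | nil => simp [← hP.length_eq] at h
        | cons x P =>
          exact ⟨x, hP.subset (by simp), P, (List.cons_perm_iff_perm_erase.1 hP).2, rfl⟩
      · rintro ⟨x, hx, P, hP, rfl⟩
        exact List.cons_perm_iff_perm_erase.2 ⟨hx, hP⟩
    rw [hS, card_biUnion, sum_mul]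
    -- The words with first letter `x` contribute `l.count x * n!`, and the multiplicities sum to `n
    -- + 1`.
    · have hterm : ∀ x ∈ l.toFinset,
          #((l.erase x).permutations.toFinset.map ⟨List.cons x, List.cons_injective⟩) *
            ∏ y ∈ l.toFinset, (l.count y).factorial = l.count x * n.factorial := by
        intro x hx
        have hxl : x ∈ l := by simpa using hx
        have hpos : 0 < l.count x := List.count_pos_iff.2 hxl
        rw [card_map, ← card_permutations_toFinset_mul n (l.erase x)
          (by rw [List.length_erase_of_mem hxl, h]; rfl)]
        have h1 : ∏ y ∈ (l.erase x).toFinset, ((l.erase x).count y).factorial =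
            ∏ y ∈ l.toFinset, ((l.erase x).count y).factorial := by
          refine prod_subset (fun y hy => ?_) fun y _ hy => ?_
          · rw [List.mem_toFinset] at hy ⊢
            exact List.mem_of_mem_erase hy
          · rw [List.mem_toFinset] at hy
            rw [List.count_eq_zero_of_not_mem hy, Nat.factorial_zero]
        rw [h1, ← mul_prod_erase _ _ hx, ← mul_prod_erase _ (fun y => (List.count y _).factorial) hx]
        have h2 : ∏ y ∈ l.toFinset.erase x, ((l.erase x).count y).factorial =
            ∏ y ∈ l.toFinset.erase x, (l.count y).factorial := by
          refine prod_congr rfl fun y hy => ?_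
          rw [List.count_erase_of_ne (ne_of_mem_erase hy)]
        rw [h2, List.count_erase_self, ← Nat.mul_factorial_pred hpos.ne']
        ring
      rw [sum_congr rfl hterm, ← sum_mul, List.sum_toFinset_count_eq_length, h,
        Nat.factorial_succ]
    · intro x _ y _ hxy
      rw [Function.onFun, disjoint_left]
      intro P hP hP'
      simp only [mem_map, Function.Embedding.coeFn_mk] at hP hP'
      obtain ⟨P₁, _, rfl⟩ := hP
      obtain ⟨P₂, _, h2⟩ := hP'
      exact hxy (List.cons.inj h2).1.symm

/-- Product of the factorials of the multiplicities of the letters. -/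
def countFactorial {α : Type*} [DecidableEq α] (l : List α) : ℕ :=
  ∏ x ∈ l.toFinset, (l.count x).factorial

theorem countFactorial_perm {α : Type*} [DecidableEq α] {l l' : List α} (h : l.Perm l') :
    countFactorial l = countFactorial l' := by
  unfold countFactorial
  rw [List.toFinset_eq_of_perm _ _ h]
  simp_rw [h.count_eq]

theorem countFactorial_append {α : Type*} [DecidableEq α] {l l' : List α} (h : l.Disjoint l') :
    countFactorial (l ++ l') = countFactorial l * countFactorial l' := by
  unfold countFactorial
  rw [List.toFinset_append, prod_union (by simpa [List.disjoint_toFinset_iff_disjoint] using h)]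
  congr 1
  · refine prod_congr rfl fun x hx => ?_
    rw [List.count_append, List.count_eq_zero_of_not_mem (h (by simpa using hx)), add_zero]
  · refine prod_congr rfl fun x hx => ?_
    rw [List.count_append, List.count_eq_zero_of_not_mem fun h' => h h' (by simpa using hx),
      zero_add]

theorem countFactorial_replicate {α : Type*} [DecidableEq α] (c : ℕ) (x : α) :
    countFactorial (List.replicate c x) = c.factorial := by
  cases c with
  | zero => simp [countFactorial]
  | succ c => simp [countFactorial, List.toFinset_replicate_of_ne_zero]

/-- The number under the bar, or the plain number. -/
def AreaLetter.value : AreaLetter → ℕ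
  | .plain k => k
  | .barred k => k

theorem le_value_of_mem_areaCodeFrom (r : ℕ) : ∀ (w : List FStep) (x : ℕ) (y : AreaLetter),
    y ∈ areaCodeFrom r x w → x ≤ y.value
  | [], x, y, h => by simp [areaCodeFrom] at h
  | .down :: w, x, y, h => by
    rw [areaCodeFrom, List.mem_cons] at h
    rcases h with rfl | h
    · exact le_rfl
    · exact le_value_of_mem_areaCodeFrom r w x y h
  | .right :: w, x, y, h => by
    rw [areaCodeFrom] at h
    exact (Nat.le_succ x).trans (le_value_of_mem_areaCodeFrom r w _ y h)
  | .diag :: w, x, y, h => by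
    rw [areaCodeFrom, List.mem_append] at h
    rcases h with h | h
    · rw [List.eq_of_mem_replicate h]; exact le_rfl
    · exact (Nat.le_succ x).trans (le_value_of_mem_areaCodeFrom r w _ y h)

theorem notMem_areaCodeFrom (r : ℕ) (w : List FStep) {x : ℕ} {y : AreaLetter} (h : y.value < x) :
    y ∉ areaCodeFrom r x w :=
  fun h' => absurd (le_value_of_mem_areaCodeFrom r w x y h') (not_le.2 h)

/-- Product of the factorials of the numbers of down steps on the abscissas, where `c` down steps
precede the path on its first abscissa. -/
def downFactorial : ℕ → List FStep → ℕ
  | c, [] => c.factorial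
  | c, .down :: w => downFactorial (c + 1) w
  | c, .right :: w => c.factorial * downFactorial 0 w
  | c, .diag :: w => c.factorial * downFactorial 0 w

theorem downFactorial_pos : ∀ (c : ℕ) (w : List FStep), 0 < downFactorial c w
  | c, [] => c.factorial_pos
  | c, .down :: w => downFactorial_pos (c + 1) w
  | c, .right :: w => Nat.mul_pos c.factorial_pos (downFactorial_pos 0 w)
  | c, .diag :: w => Nat.mul_pos c.factorial_pos (downFactorial_pos 0 w)

/-- A path leaves an abscissa for good by its right or diagonal step, so each barred letter comes
from a single diagonal step and has multiplicity `r`, while the multiplicity of a plain letter is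
the number of down steps on its abscissa. -/
theorem countFactorial_areaCodeFrom (r : ℕ) : ∀ (w : List FStep) (c x : ℕ),
    countFactorial (List.replicate c (AreaLetter.plain x) ++ areaCodeFrom r x w) =
      r.factorial ^ w.count .diag * downFactorial c w
  | [], c, x => by simp [areaCodeFrom, countFactorial_replicate, downFactorial]
  | .down :: w, c, x => by
    rw [areaCodeFrom, countFactorial_perm List.perm_middle,
      ← List.cons_append, ← List.replicate_succ, countFactorial_areaCodeFrom r w (c + 1) x]
    simp [downFactorial]
  | .right :: w, c, x => by
    have ih := countFactorial_areaCodeFrom r w 0 (x + 1)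
    rw [areaCodeFrom, countFactorial_append, countFactorial_replicate]
    · simp only [List.replicate_zero, List.nil_append] at ih
      rw [ih, downFactorial]
      simp only [List.count_cons, beq_iff_eq, reduceCtorEq, if_false, add_zero]
      ring
    · intro y hy
      rw [List.eq_of_mem_replicate hy]
      exact notMem_areaCodeFrom r w (Nat.lt_succ_self x)
  | .diag :: w, c, x => by
    have ih := countFactorial_areaCodeFrom r w 0 (x + 1)
    rw [areaCodeFrom, countFactorial_append, countFactorial_append, countFactorial_replicate,
      countFactorial_replicate]
    · simp only [List.replicate_zero, List.nil_append] at ih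
      rw [ih, downFactorial, List.count_cons_self]
      ring
    · intro y hy
      rw [List.eq_of_mem_replicate hy]
      exact notMem_areaCodeFrom r w (Nat.lt_succ_self x)
    · intro y hy h
      rw [List.eq_of_mem_replicate hy, List.mem_append] at h
      rcases h with h | h
      · exact absurd (List.eq_of_mem_replicate h) (by simp)
      · exact notMem_areaCodeFrom r w (by exact Nat.lt_succ_self x) h

theorem length_areaCodeFrom (r : ℕ) : ∀ (w : List FStep) (x : ℕ),
    (areaCodeFrom r x w).length = w.count .down + w.count .diag * r
  | [], x => by simp [areaCodeFrom]
  | .down :: w, x => by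
    simp [areaCodeFrom, length_areaCodeFrom r w x]; ring
  | .right :: w, x => by
    simp [areaCodeFrom, length_areaCodeFrom r w (x + 1)]
  | .diag :: w, x => by
    simp [areaCodeFrom, length_areaCodeFrom r w (x + 1)]; ring

theorem endX_eq_count : ∀ w : List FStep, endX w = w.count .right + w.count .diag
  | [] => by simp [endX]
  | x :: w => by
    have ih := endX_eq_count w
    simp only [endX] at ih
    cases x <;> simp [endX, FStep.dx, ih] <;> ring

theorem endY_eq_count (n r : ℕ) : ∀ w : List FStep,
    endY n r w = n * r - w.count .down - r * w.count .diag
  | [] => by simp [endY]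
  | x :: w => by
    have ih := endY_eq_count n r w
    simp only [endY] at ih
    rw [endY, List.map_cons, List.sum_cons, add_left_comm, ih]
    cases x <;> simp [FStep.dy] <;> ring

/-! ### Recovering a path from its coding. -/

/-- The path is determined by its width and the multiset of letters of its coding. -/
theorem eq_of_areaCodeFrom_perm (r : ℕ) (hr : 1 ≤ r) : ∀ (w w' : List FStep) (x : ℕ),
    endX w = endX w' → (areaCodeFrom r x w).Perm (areaCodeFrom r x w') → w = w' := by
  have hbar : ∀ (x : ℕ) (w : List FStep), AreaLetter.barred x ∈ areaCodeFrom r x (.diag :: w) := by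
    intro x w
    rw [areaCodeFrom, List.mem_append]
    exact Or.inl (List.mem_replicate.2 ⟨by omega, rfl⟩)
  have hdown : ∀ (x : ℕ) (w : List FStep), AreaLetter.plain x ∈ areaCodeFrom r x (.down :: w) := by
    intro x w
    simp [areaCodeFrom]
  have hright : ∀ (x : ℕ) (w : List FStep) (y : AreaLetter), y.value = x →
      y ∉ areaCodeFrom r x (.right :: w) := by
    intro x w y hy
    rw [areaCodeFrom]
    exact notMem_areaCodeFrom r w (by omega)
  have hdiag : ∀ (x : ℕ) (w : List FStep), AreaLetter.plain x ∉ areaCodeFrom r x (.diag :: w) := by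
    intro x w h
    rw [areaCodeFrom, List.mem_append] at h
    rcases h with h | h
    · exact absurd (List.eq_of_mem_replicate h) (by simp)
    · exact notMem_areaCodeFrom r w (by exact Nat.lt_succ_self x) h
  have hnil : ∀ (x : ℕ) (s : FStep) (w : List FStep), endX [] = endX (s :: w) →
      (areaCodeFrom r x []).Perm (areaCodeFrom r x (s :: w)) → False := by
    intro x s w h1 h2
    cases s with
    | down => simp [areaCodeFrom] at h2
    | right => rw [endX_eq_count, endX_eq_count] at h1; simp at h1; omega
    | diag => rw [endX_eq_count, endX_eq_count] at h1; simp at h1; omega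
  have hend : ∀ (s : FStep) (w w' : List FStep), endX (s :: w) = endX (s :: w') →
      endX w = endX w' := by
    intro s w w' h
    simpa [endX] using h
  intro w
  induction w with
  | nil =>
    intro w' x h1 h2
    cases w' with
    | nil => rfl
    | cons s w' => exact (hnil x s w' h1 h2).elim
  | cons s w ih =>
    intro w' x h1 h2
    cases w' with
    | nil => exact (hnil x s w h1.symm h2.symm).elim
    | cons s' w' =>
      -- The letters of value `x` reveal the first step: a plain one occurs iff it is down;
      -- otherwise a barred one occurs iff it is diagonal. Right steps leave no letter, so the width
      -- is needed to recover trailing ones.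
      cases s <;> cases s'
      · rw [ih w' x (hend _ _ _ h1) (by simpa [areaCodeFrom] using h2)]
      · exact (hright x w' _ rfl (h2.subset (hdown x w))).elim
      · exact (hdiag x w' (h2.subset (hdown x w))).elim
      · exact (hright x w _ rfl (h2.symm.subset (hdown x w'))).elim
      · rw [ih w' (x + 1) (hend _ _ _ h1) (by simpa [areaCodeFrom] using h2)]
      · exact (hright x w _ rfl (h2.symm.subset (hbar x w'))).elim
      · exact (hdiag x w (h2.symm.subset (hdown x w'))).elim
      · exact (hright x w' _ rfl (h2.subset (hbar x w))).elim
      · rw [ih w' (x + 1) (hend _ _ _ h1) (by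
          simpa [areaCodeFrom, List.perm_append_left_iff] using h2)]

/-! ### Total weight of the paths below the line. -/

/-- Paths with `a` down, `b` right and `m` diagonal steps that start with slack `s` and stay weakly
below the boundary line. -/
def IsSlackPath (r m a b : ℕ) (s : ℤ) (w : List FStep) : Prop :=
  w.count .down = a ∧ w.count .right = b ∧ w.count .diag = m ∧
    ∀ u, u <+: w → 0 ≤ s + u.count .down - r * u.count .right

theorem IsSlackPath.nonneg {r m a b : ℕ} {s : ℤ} {w : List FStep} (h : IsSlackPath r m a b s w) :
    0 ≤ s := by
  simpa using h.2.2.2 [] List.nil_prefix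

theorem forall_prefix_cons {α : Type*} (x : α) (w : List α) (p : List α → Prop) :
    (∀ u, u <+: x :: w → p u) ↔ p [] ∧ ∀ u, u <+: w → p (x :: u) := by
  constructor
  · exact fun h => ⟨h _ List.nil_prefix, fun u hu => h _ ((List.prefix_cons_inj x).2 hu)⟩
  · rintro ⟨h1, h2⟩ u hu
    cases u with
    | nil => exact h1
    | cons y u =>
      obtain ⟨rfl, huw⟩ := List.cons_prefix_cons.1 hu
      exact h2 u huw

theorem isSlackPath_nil {r m a b : ℕ} {s : ℤ} (hs : 0 ≤ s) :
    IsSlackPath r m a b s [] ↔ m = 0 ∧ a = 0 ∧ b = 0 := by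
  simp only [IsSlackPath, List.count_nil, List.prefix_nil, forall_eq]
  constructor
  · rintro ⟨rfl, rfl, rfl, _⟩; simp
  · rintro ⟨rfl, rfl, rfl⟩; simpa using hs

theorem isSlackPath_down {r m a b : ℕ} {s : ℤ} (hs : 0 ≤ s) (w : List FStep) :
    IsSlackPath r m a b s (.down :: w) ↔ ∃ a', a = a' + 1 ∧ IsSlackPath r m a' b (s + 1) w := by
  have e : ∀ x y : ℤ, s + (x + 1) - r * y = s + 1 + x - r * y := by intro x y; ring
  simp only [IsSlackPath, forall_prefix_cons]
  simp only [List.count_cons, beq_self_eq_true, if_true, List.count_nil, beq_iff_eq, reduceCtorEq,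
    if_false, add_zero, Nat.cast_add, Nat.cast_one, Nat.cast_zero, mul_zero, sub_zero, hs, true_and,
    e]
  constructor
  · rintro ⟨rfl, h⟩; exact ⟨_, rfl, rfl, h⟩
  · rintro ⟨_, rfl, rfl, h⟩; exact ⟨rfl, h⟩

theorem isSlackPath_right {r m a b : ℕ} {s : ℤ} (hs : 0 ≤ s) (w : List FStep) :
    IsSlackPath r m a b s (.right :: w) ↔ ∃ b', b = b' + 1 ∧ IsSlackPath r m a b' (s - r) w := by
  have e : ∀ x y : ℤ, s + x - r * (y + 1) = s - r + x - r * y := by intro x y; ring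
  simp only [IsSlackPath, forall_prefix_cons]
  simp only [List.count_cons, beq_self_eq_true, if_true, List.count_nil, beq_iff_eq, reduceCtorEq,
    if_false, add_zero, Nat.cast_add, Nat.cast_one, Nat.cast_zero, mul_zero, sub_zero, hs, true_and,
    e]
  constructor
  · rintro ⟨h, rfl, h'⟩; exact ⟨_, rfl, h, rfl, h'⟩
  · rintro ⟨_, rfl, h, rfl, h'⟩; exact ⟨h, rfl, h'⟩

theorem isSlackPath_diag {r m a b : ℕ} {s : ℤ} (hs : 0 ≤ s) (w : List FStep) :
    IsSlackPath r m a b s (.diag :: w) ↔ ∃ m', m = m' + 1 ∧ IsSlackPath r m' a b s w := by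
  simp only [IsSlackPath, forall_prefix_cons]
  simp only [List.count_cons, beq_self_eq_true, if_true, List.count_nil, beq_iff_eq, reduceCtorEq,
    if_false, add_zero, Nat.cast_zero, mul_zero, sub_zero, hs, true_and]
  constructor
  · rintro ⟨h, h', rfl, h''⟩; exact ⟨_, rfl, h, h', rfl, h''⟩
  · rintro ⟨_, rfl, h, h', rfl, h''⟩; exact ⟨h, h', rfl, h''⟩

/-- Weight of a block, on whose first abscissa `c` down steps have been made already, followed by
`m` blocks. -/
def pathWeight (r c m a b : ℕ) (s : ℤ) : ℚ :=
  ∑ x ∈ antidiagonal a, ∑ y ∈ antidiagonal b,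
    blockWeight r c y.1 x.1 s * chainWeight r m x.2 y.2 (s + x.1 - r * y.1)

/-- The contribution to `pathWeight` of the paths that start with a down step. -/
def pathWeightDown (r c m : ℕ) : ℕ → ℕ → ℤ → ℚ
  | 0, _, _ => 0
  | a + 1, b, s => pathWeight r (c + 1) m a b (s + 1)

/-- The contribution to `pathWeight`, up to a factor `1 / c!`, of the paths that start with a right
step. -/
def pathWeightRight (r m a : ℕ) : ℕ → ℤ → ℚ
  | 0, _ => 0
  | b + 1, s => if (r : ℤ) ≤ s then pathWeight r 0 m a b (s - r) else 0

/-- Decomposition by the first step. In the last term the first block ends at once, by a diagonal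
step or, if `m = 0`, at the end of the path. -/
theorem pathWeight_eq (r c m a b : ℕ) (s : ℤ) :
    pathWeight r c m a b s = pathWeightDown r c m a b s +
      1 / (c.factorial : ℚ) * pathWeightRight r m a b s +
      1 / (c.factorial : ℚ) * chainWeight r m a b s := by
  have ex : ∀ (x : ℕ) (z : ℤ), s + ((x + 1 : ℕ) : ℤ) - z = s + 1 + x - z := by
    intro x z; push_cast; ring
  have ey : ∀ (x : ℤ) (y : ℕ), s + x - (r : ℤ) * ((y + 1 : ℕ) : ℤ) = s - r + x - r * y := by
    intro x y; push_cast; ring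
  have hR : ∀ b : ℕ, pathWeightRight r m a (b + 1) s = ∑ x ∈ antidiagonal a,
      ∑ y ∈ antidiagonal b, (if (r : ℤ) ≤ s then blockWeight r 0 y.1 x.1 (s - r) else 0) *
        chainWeight r m x.2 y.2 (s - r + x.1 - r * y.1) := by
    intro b
    rw [pathWeightRight]
    split_ifs
    · rfl
    · simp
  cases a with
  | zero =>
    cases b with
    | zero => simp [pathWeight, pathWeightDown, pathWeightRight, blockWeight_zero_right]
    | succ b =>
      rw [hR]
      simp only [pathWeight, pathWeightDown, HasAntidiagonal.antidiagonal_zero, sum_singleton,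
        Finset.Nat.sum_antidiagonal_succ, blockWeight_zero_right, blockWeight_succ_zero, ey,
        mul_sum, zero_add, mul_assoc]
      simp [add_comm]
  | succ a =>
    cases b with
    | zero =>
      simp only [pathWeight, pathWeightDown, pathWeightRight, HasAntidiagonal.antidiagonal_zero,
        sum_singleton, Finset.Nat.sum_antidiagonal_succ, blockWeight_zero_succ, ex]
      simp [blockWeight_zero_right, add_comm]
    | succ b =>
      rw [hR]
      simp only [pathWeight, pathWeightDown, Finset.Nat.sum_antidiagonal_succ,
        blockWeight_zero_succ, blockWeight_succ_succ, blockWeight_succ_zero, ey, mul_add,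
        sum_add_distrib, add_mul, mul_sum, mul_assoc]
      simp only [ex, blockWeight_zero_right]
      have ec : ∀ x y : ℕ, s - r + ((x + 1 : ℕ) : ℤ) - r * (y : ℤ) = s + 1 - r + x - r * y := by
        intro x y; push_cast; ring
      have ed : ∀ x y : ℕ, s + 1 + (x : ℤ) - r * ((y + 1 : ℕ) : ℤ) = s + 1 - r + x - r * y := by
        intro x y; push_cast; ring
      simp only [ec, ed]
      simp
      ring

theorem chainWeight_succ (r m a b : ℕ) (s : ℤ) :
    chainWeight r (m + 1) a b s = pathWeight r 0 m a b s := rfl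

/-- The paths below the boundary line form a finite set, of total weight `pathWeight`. -/
theorem exists_finset_isSlackPath (r : ℕ) : ∀ (L m a b : ℕ) (s : ℤ), m + a + b = L → 0 ≤ s →
    ∃ S : Finset (List FStep), (∀ w, w ∈ S ↔ IsSlackPath r m a b s w) ∧
      ∀ c, ∑ w ∈ S, 1 / (downFactorial c w : ℚ) = pathWeight r c m a b s := by
  intro L
  induction L using Nat.strong_induction_on with
  | _ L ih =>
  intro m a b s hL hs
  let consEmb (x : FStep) : List FStep ↪ List FStep := ⟨List.cons x, List.cons_injective⟩
  -- `D` and `R` hold the tails after a first down or right step; `G` holds the whole paths that are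
  -- empty or start with a diagonal step.
  obtain ⟨D, hD, hDs⟩ : ∃ D : Finset (List FStep),
      (∀ w, w ∈ D ↔ ∃ a', a = a' + 1 ∧ IsSlackPath r m a' b (s + 1) w) ∧
      ∀ c, ∑ w ∈ D, 1 / (downFactorial (c + 1) w : ℚ) = pathWeightDown r c m a b s := by
    cases a with
    | zero => exact ⟨∅, by simp, by simp [pathWeightDown]⟩
    | succ a =>
      obtain ⟨D, h1, h2⟩ := ih (m + a + b) (by omega) m a b (s + 1) rfl (by omega)
      exact ⟨D, by simp [h1], fun c => h2 (c + 1)⟩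
  obtain ⟨R, hR, hRs⟩ : ∃ R : Finset (List FStep),
      (∀ w, w ∈ R ↔ ∃ b', b = b' + 1 ∧ IsSlackPath r m a b' (s - r) w) ∧
      ∑ w ∈ R, 1 / (downFactorial 0 w : ℚ) = pathWeightRight r m a b s := by
    cases b with
    | zero => exact ⟨∅, by simp, by simp [pathWeightRight]⟩
    | succ b =>
      by_cases h : (r : ℤ) ≤ s
      · obtain ⟨R, h1, h2⟩ := ih (m + a + b) (by omega) m a b (s - r) rfl (by omega)
        exact ⟨R, by simp [h1], by rw [h2, pathWeightRight, if_pos h]⟩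
      · refine ⟨∅, fun w => ⟨by simp, ?_⟩, by rw [pathWeightRight, if_neg h, sum_empty]⟩
        rintro ⟨b', _, hw⟩
        exact absurd hw.nonneg (by omega)
  obtain ⟨G, hG, hGs⟩ : ∃ G : Finset (List FStep),
      (∀ w, w ∈ G ↔ (w = [] ∧ m = 0 ∧ a = 0 ∧ b = 0) ∨
        ∃ v, w = .diag :: v ∧ ∃ m', m = m' + 1 ∧ IsSlackPath r m' a b s v) ∧
      ∀ c, ∑ w ∈ G, 1 / (downFactorial c w : ℚ) =
        1 / (c.factorial : ℚ) * chainWeight r m a b s := by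
    cases m with
    | zero =>
      by_cases h : a = 0 ∧ b = 0
      · exact ⟨{[]}, by simp [h], by simp [chainWeight, h, downFactorial]⟩
      · exact ⟨∅, by simpa using h, by simp [chainWeight, h]⟩
    | succ m =>
      obtain ⟨G, h1, h2⟩ := ih (m + a + b) (by omega) m a b s rfl hs
      refine ⟨G.map (consEmb .diag), fun w => ?_, fun c => ?_⟩
      · simp [consEmb, h1, and_comm, eq_comm]
      · rw [chainWeight_succ, ← h2, mul_sum, sum_map]
        refine sum_congr rfl fun w _ => ?_
        simp only [consEmb, Function.Embedding.coeFn_mk, downFactorial]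
        push_cast
        rw [one_div_mul_one_div]
  have hdisj1 : Disjoint (D.map (consEmb .down)) (R.map (consEmb .right)) := by
    simp [disjoint_left, consEmb]
  have hdisj2 : Disjoint ((D.map (consEmb .down)).disjUnion (R.map (consEmb .right)) hdisj1) G := by
    rw [disjoint_left]
    intro w hw hw'
    rw [hG] at hw'
    rcases hw' with ⟨rfl, _⟩ | ⟨v, rfl, _⟩ <;> simp [consEmb] at hw
  refine ⟨((D.map (consEmb .down)).disjUnion (R.map (consEmb .right)) hdisj1).disjUnion G hdisj2,
    fun w => ?_, fun c => ?_⟩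
  · simp only [mem_disjUnion, mem_map, hG, hD, hR, consEmb, Function.Embedding.coeFn_mk]
    rcases w with _ | ⟨x, w⟩
    · simp [isSlackPath_nil hs]
    · cases x
      · simp [isSlackPath_down hs]
      · simp [isSlackPath_right hs]
      · simp [isSlackPath_diag hs]
  · rw [sum_disjUnion, sum_disjUnion, sum_map, sum_map, hGs, pathWeight_eq, ← hDs, ← hRs, mul_sum]
    congr 2
    refine sum_congr rfl fun w _ => ?_
    simp only [consEmb, Function.Embedding.coeFn_mk, downFactorial]
    push_cast
    rw [one_div_mul_one_div]

/-! ### Assembly. -/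

/-- The slack equals the number of down steps minus `r` times the number of right steps. The end
point `(n, 0)` has slack zero, so `d` down steps force `d / r` right and `n - d / r` diagonal ones.
-/
theorem mem_FSch_iff {n d r : ℕ} (hr : 1 ≤ r) (hrd : r ∣ d) (hd : d ≤ n * r) (w : List FStep) :
    w ∈ FSch n d r ↔ IsSlackPath r (n - d / r) d (d / r) 0 w := by
  obtain ⟨e, rfl⟩ := hrd
  have hen : e ≤ n := by
    rw [mul_comm] at hd; exact Nat.le_of_mul_le_mul_right hd hr
  rw [Nat.mul_div_cancel_left e hr]
  have hslack : ∀ u : List FStep, (r : ℤ) * endX u + endY n r u ≤ n * r ↔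
      0 ≤ (0 : ℤ) + u.count .down - r * u.count .right := by
    intro u
    rw [endX_eq_count, endY_eq_count]
    constructor <;> intro h <;> linarith
  simp only [FSch, IsFSchroder, Set.mem_ofPred_eq, IsSlackPath, hslack]
  rw [endX_eq_count, endY_eq_count]
  have hr0 : (r : ℤ) ≠ 0 := by omega
  constructor
  · rintro ⟨⟨h1, h2, h3⟩, h4⟩
    have h5 : (w.count .diag : ℤ) = n - e := by
      apply mul_left_cancel₀ hr0
      rw [h4] at h2
      push_cast at h2
      linarith
    exact ⟨h4, by omega, by omega, h3⟩
  · rintro ⟨h1, h2, h3, h4⟩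
    refine ⟨⟨by omega, ?_, h4⟩, h1⟩
    rw [h1, h3]
    push_cast [hen]
    ring

theorem parkingFSch_eq_biUnion {n d r : ℕ} {S : Finset (List FStep)}
    (hS : ∀ w, w ∈ S ↔ w ∈ FSch n d r) :
    parkingFSch n d r = (S.biUnion fun w => (areaCode r w).permutations.toFinset : Finset _) := by
  ext P
  simp [parkingFSch, hS, List.mem_permutations]

theorem card_permutations_areaCode_mul (r : ℕ) (w : List FStep) :
    #(areaCode r w).permutations.toFinset * (r.factorial ^ w.count .diag * downFactorial 0 w) =
      (w.count .down + w.count .diag * r).factorial := by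
  have h := countFactorial_areaCodeFrom r w 0 0
  simp only [List.replicate_zero, List.nil_append] at h
  rw [← h]
  exact card_permutations_toFinset_mul _ _ (length_areaCodeFrom r w 0)

theorem multinomial_cons_const_mul (d r m : ℕ) :
    Nat.multinomial univ (Fin.cons d (fun _ => r) : Fin (m + 1) → ℕ) *
      (d.factorial * r.factorial ^ m) = (d + m * r).factorial := by
  have h := Nat.multinomial_spec univ (Fin.cons d (fun _ => r) : Fin (m + 1) → ℕ)
  rw [mul_comm]
  simpa [Fin.prod_univ_succ, Fin.sum_univ_succ] using h

theorem mainTheorem3 (n d r : ℕ) (hr : 1 ≤ r) (hrd : r ∣ d) (hd : d ≤ n * r) :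
    (parkingFSch n d r).Finite ∧
    (parkingFSch n d r).ncard =
      Nat.multinomial univ (Fin.cons d (fun _ => r) : Fin (n - d / r + 1) → ℕ) *
        ∑ i ∈ range (d + d / r + 1), (n - d / r + 1).choose i * sumF d r i := by
  obtain ⟨S, hS, hsum⟩ := exists_finset_isSlackPath r _ (n - d / r) d (d / r) 0 rfl le_rfl
  have hS' : ∀ w, w ∈ S ↔ w ∈ FSch n d r := fun w => by rw [hS, mem_FSch_iff hr hrd hd]
  rw [parkingFSch_eq_biUnion hS']
  refine ⟨finite_toSet _, ?_⟩
  rw [Set.ncard_coe_finset, card_biUnion]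
  · generalize n - d / r = m at *
    have hcard : ∀ w ∈ S, (#(areaCode r w).permutations.toFinset : ℚ) =
        Nat.multinomial univ (Fin.cons d (fun _ => r) : Fin (m + 1) → ℕ) * d.factorial *
          (1 / (downFactorial 0 w : ℚ)) := by
      intro w hw
      obtain ⟨h1, _, h2, _⟩ := (hS w).1 hw
      have h := card_permutations_areaCode_mul r w
      rw [h1, h2, ← multinomial_cons_const_mul] at h
      have h3 : (downFactorial 0 w : ℚ) ≠ 0 := by exact_mod_cast (downFactorial_pos 0 w).ne'
      have h4 : ((r.factorial ^ m : ℕ) : ℚ) ≠ 0 := by positivity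
      rw [mul_one_div, eq_div_iff h3]
      apply mul_right_cancel₀ h4
      exact_mod_cast (by linarith : _ * downFactorial 0 w * r.factorial ^ m = _)
    rw [← Nat.cast_inj (R := ℚ)]
    push_cast
    rw [sum_congr rfl hcard, ← mul_sum, hsum 0, ← chainWeight_succ, chainWeight_eq_sum_range,
      mul_assoc, mul_sum]
    congr 1
    refine sum_congr rfl fun i _ => ?_
    rw [sumF_eq_factorial_mul d r i hr]
    ring
  -- A word common to two classes makes the two codings rearrangements of each other; both paths
  -- have width `n`, so they coincide.
  · intro w hw w' hw' hne
    rw [Function.onFun, disjoint_left]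
    intro P hP hP'
    rw [List.mem_toFinset, List.mem_permutations] at hP hP'
    have h1 := ((hS' w).1 hw).1.1
    have h2 := ((hS' w').1 hw').1.1
    exact hne (eq_of_areaCodeFrom_perm r hr w w' 0 (h1.trans h2.symm) (hP.symm.trans hP'))
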